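/- Let $F$ be a field of characteristic not $2$, let $r\ge 0$, $s\ge 1$, $n\ge 0$ be integers, and suppose that a sums-of-squares formula of type $[r,s,n]$ exists over $F$, i.e. an identity $$(x_1^2+\cdots+x_r^2)(y_1^2+\cdots+y_s^2)=z_1^2+\cdots+z_n^2$$ in $F[x_1,\dots,x_r,y_1,\dots,y_s]$ in which every $z_k$ is a bilinear expression $\sum_{i,j}c_{kij}x_iy_j$ with $c_{kij}\in F$. Let $X=\mathbb P^{s-1}_F-V_q$, where $V_q\subseteq\mathbb P^{s-1}_F$ is the closed subset defined by $q(y)=y_1^2+\cdots+y_s^2=0$, and let $\xi$ be the restriction to $X$ of the tautological line bundle $\mathcal O(-1)$ of $\mathbb P^{s-1}_F$. Then $r\le n$, and there is an algebraic vector bundle $\zeta$ on $X$ of rank $n-r$ such that $$r[\xi]+[\zeta]=n$$ in $K^0(X)$, the Grothendieck group of locally free coherent sheaves on $X$, where $n$ denotes $n[\mathcal O_X]$. -/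

import Mathlib

open CategoryTheory TopologicalSpace Opposite

universe u

/-! ## Twisting sheaves on `Proj` -/

namespace ProjTwist

open AlgebraicGeometry

variable {A : Type u} {σ : Type u} [CommRing A] [SetLike σ A] [AddSubgroupClass σ A]
variable (𝒜 : ℕ → σ) [GradedRing 𝒜]

/-- The localization `A_𝔭` of the whole ring `A` at a point `𝔭` of `Proj 𝒜`. -/
abbrev Stalk (x : ProjectiveSpectrum.top 𝒜) : Type u :=
  haveI : x.asHomogeneousIdeal.toIdeal.IsPrime := ProjectiveSpectrum.isPrime x
  Localization.AtPrime x.asHomogeneousIdeal.toIdeal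

/-- A dependent function on an open set is a fraction of degree `d : ℤ` if it is given by a
single `a / b` with `a`, `b` homogeneous, `deg a - deg b = d` and `b` nowhere vanishing. -/
def IsFraction (d : ℤ) {U : Opens (ProjectiveSpectrum.top 𝒜)} (f : ∀ x : U, Stalk 𝒜 x.1) : Prop :=
  ∃ (i j : ℕ) (_ : (i : ℤ) = j + d) (a : 𝒜 i) (b : 𝒜 j)
    (hb : ∀ x : U, b.1 ∉ x.1.asHomogeneousIdeal.toIdeal),
    ∀ x : U, f x = Localization.mk a.1 ⟨b.1, hb x⟩

def isFractionPrelocal (d : ℤ) : TopCat.PrelocalPredicate (X := ProjectiveSpectrum.top 𝒜) (Stalk 𝒜) where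
  pred f := IsFraction 𝒜 d f
  res := by
    rintro V U i f ⟨j, k, h, a, b, hb, w⟩
    exact ⟨j, k, h, a, b, fun x => hb (i x), fun x => w (i x)⟩

/-- Functions which are, locally, fractions of degree `d`. -/
def isLocallyFraction (d : ℤ) : TopCat.LocalPredicate (X := ProjectiveSpectrum.top 𝒜) (Stalk 𝒜) :=
  (isFractionPrelocal 𝒜 d).sheafify

variable {𝒜} in
theorem add_mem' {d : ℤ} {U : Opens (ProjectiveSpectrum.top 𝒜)} {f g : ∀ x : U, Stalk 𝒜 x.1}
    (hf : (isLocallyFraction 𝒜 d).pred f) (hg : (isLocallyFraction 𝒜 d).pred g) :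
    (isLocallyFraction 𝒜 d).pred (f + g) := fun x => by
  obtain ⟨V, mV, iV, i, j, hij, a, b, hb, w⟩ := hf x
  obtain ⟨W, mW, iW, k, l, hkl, a', b', hb', w'⟩ := hg x
  refine ⟨V ⊓ W, ⟨mV, mW⟩, Opens.infLELeft _ _ ≫ iV, i + l, j + l, by push_cast; omega,
    ⟨b'.1 * a.1 + b.1 * a'.1, ?_⟩, ⟨b.1 * b'.1, SetLike.mul_mem_graded b.2 b'.2⟩,
    fun y h => (ProjectiveSpectrum.isPrime y.1).mem_or_mem h |>.elim
      (hb ⟨y.1, y.2.1⟩) (hb' ⟨y.1, y.2.2⟩), ?_⟩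
  · have h1 : b'.1 * a.1 ∈ 𝒜 (i + l) := by
      have := SetLike.mul_mem_graded b'.2 a.2
      rwa [add_comm l i] at this
    have h2 : b.1 * a'.1 ∈ 𝒜 (i + l) := by
      have := SetLike.mul_mem_graded b.2 a'.2
      rwa [show j + k = i + l by omega] at this
    exact add_mem h1 h2
  · rintro ⟨y, hy⟩
    have h1 := w ⟨y, hy.1⟩
    have h2 := w' ⟨y, hy.2⟩
    change f (iV ⟨y, hy.1⟩) + g (iW ⟨y, hy.2⟩) = _
    refine (congrArg₂ (· + ·) h1 h2).trans ?_
    rw [Localization.add_mk]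
    congr 1
    simp only [add_comm]

variable {𝒜} in
theorem exists_homogeneous (x : ProjectiveSpectrum.top 𝒜) :
    ∃ (m : ℕ) (b : 𝒜 m), 0 < m ∧ b.1 ∉ x.asHomogeneousIdeal.toIdeal := by
  classical
  by_contra! H
  refine x.not_irrelevant_le fun a ha => ?_
  change a ∈ x.asHomogeneousIdeal.toIdeal
  rw [← DirectSum.sum_support_decompose 𝒜 a]
  refine Ideal.sum_mem _ fun i _ => ?_
  rcases Nat.eq_zero_or_pos i with rfl | hi
  · have : GradedRing.proj 𝒜 0 a = 0 := (HomogeneousIdeal.mem_irrelevant_iff 𝒜 a).1 ha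
    rw [GradedRing.proj_apply] at this
    rw [this]
    exact Ideal.zero_mem _
  · exact H i _ hi

variable {𝒜} in
theorem zero_mem' (d : ℤ) (U : Opens (ProjectiveSpectrum.top 𝒜)) :
    (isLocallyFraction 𝒜 d).pred (0 : ∀ x : U, Stalk 𝒜 x.1) := fun x => by
  obtain ⟨m, b, hm, hb⟩ := exists_homogeneous x.1
  have hN : 0 ≤ ((m * d.natAbs : ℕ) : ℤ) + d := by
    have h1 : d.natAbs ≤ m * d.natAbs := Nat.le_mul_of_pos_left _ hm
    omega
  refine ⟨U ⊓ ProjectiveSpectrum.basicOpen 𝒜 b.1, ⟨x.2, hb⟩, Opens.infLELeft _ _,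
    (((m * d.natAbs : ℕ) : ℤ) + d).toNat, m * d.natAbs, Int.toNat_of_nonneg hN,
    ⟨0, zero_mem _⟩, ⟨b.1 ^ d.natAbs, ?_⟩, fun y => ?_, fun y => ?_⟩
  · have := SetLike.pow_mem_graded d.natAbs b.2
    rwa [smul_eq_mul, mul_comm] at this
  · exact fun h => y.2.2 ((ProjectiveSpectrum.isPrime y.1).mem_of_pow_mem _ h)
  · exact (Localization.mk_zero _).symm

variable {𝒜} in
theorem neg_mem' {d : ℤ} {U : Opens (ProjectiveSpectrum.top 𝒜)} {f : ∀ x : U, Stalk 𝒜 x.1}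
    (hf : (isLocallyFraction 𝒜 d).pred f) : (isLocallyFraction 𝒜 d).pred (-f) := fun x => by
  obtain ⟨V, mV, iV, i, j, hij, a, b, hb, w⟩ := hf x
  refine ⟨V, mV, iV, i, j, hij, -a, b, hb, fun y => ?_⟩
  have h1 := w y
  change -(f _) = _
  change f _ = _ at h1
  rw [h1, Localization.neg_mk]
  rfl

variable {𝒜} in
theorem smul_mem' {d : ℤ} {U : Opens (ProjectiveSpectrum.top 𝒜)}
    (r : (ProjectiveSpectrum.Proj.structureSheaf 𝒜).1.obj (op U)) {f : ∀ x : U, Stalk 𝒜 x.1}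
    (hf : (isLocallyFraction 𝒜 d).pred f) :
    (isLocallyFraction 𝒜 d).pred (fun x => (r.1 x).val * f x) := fun x => by
  obtain ⟨V, mV, iV, i, j, hij, a, b, hb, w⟩ := hf x
  obtain ⟨W, mW, iW, k, a', b', hb', w'⟩ := r.2 x
  refine ⟨V ⊓ W, ⟨mV, mW⟩, Opens.infLELeft _ _ ≫ iV, k + i, k + j, by push_cast; omega,
    ⟨a'.1 * a.1, SetLike.mul_mem_graded a'.2 a.2⟩, ⟨b'.1 * b.1, SetLike.mul_mem_graded b'.2 b.2⟩,
    fun y h => (ProjectiveSpectrum.isPrime y.1).mem_or_mem h |>.elim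
      (hb' ⟨y.1, y.2.2⟩) (hb ⟨y.1, y.2.1⟩), ?_⟩
  rintro ⟨y, hy⟩
  have h1 := w ⟨y, hy.1⟩
  have h2 := w' ⟨y, hy.2⟩
  change (r.1 (iW ⟨y, hy.2⟩)).val * f (iV ⟨y, hy.1⟩) = _
  refine (congrArg₂ (· * ·) (congrArg HomogeneousLocalization.val h2) h1).trans ?_
  rw [HomogeneousLocalization.val_mk, Localization.mk_mul]
  rfl

/-- The sections over `U` of the twisting sheaf `𝒪(d)`: the functions assigning to every point
`𝔭` of `U` an element of `A_𝔭` which are locally fractions of degree `d`. -/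
def sections (d : ℤ) (U : Opens (ProjectiveSpectrum.top 𝒜)) :
    AddSubgroup (∀ x : U, Stalk 𝒜 x.1) where
  carrier := {f | (isLocallyFraction 𝒜 d).pred f}
  add_mem' := add_mem'
  zero_mem' := zero_mem' d U
  neg_mem' := neg_mem'

/-- Sections of the structure sheaf act on sections of `𝒪(d)` by pointwise multiplication. -/
instance sectionsModule (d : ℤ) (U : Opens (ProjectiveSpectrum.top 𝒜)) :
    Module ((ProjectiveSpectrum.Proj.structureSheaf 𝒜).1.obj (op U)) (sections 𝒜 d U) where
  smul r f := ⟨fun x => (r.1 x).val * f.1 x, smul_mem' r f.2⟩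
  one_smul f := Subtype.ext <| funext fun x => by
    have : x.1.asHomogeneousIdeal.toIdeal.IsPrime := ProjectiveSpectrum.isPrime x.1
    change (1 : HomogeneousLocalization.AtPrime 𝒜 x.1.asHomogeneousIdeal.toIdeal).val * f.1 x = f.1 x
    rw [HomogeneousLocalization.val_one, one_mul]
  mul_smul r s f := Subtype.ext <| funext fun x => by
    change (r.1 x * s.1 x).val * f.1 x = (r.1 x).val * ((s.1 x).val * f.1 x)
    rw [HomogeneousLocalization.val_mul, mul_assoc]
  smul_zero r := Subtype.ext <| funext fun x => mul_zero _
  smul_add r f g := Subtype.ext <| funext fun x => mul_add _ _ _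
  add_smul r s f := Subtype.ext <| funext fun x => by
    change (r.1 x + s.1 x).val * f.1 x = (r.1 x).val * f.1 x + (s.1 x).val * f.1 x
    rw [HomogeneousLocalization.val_add, add_mul]
  zero_smul f := Subtype.ext <| funext fun x => by
    have : x.1.asHomogeneousIdeal.toIdeal.IsPrime := ProjectiveSpectrum.isPrime x.1
    change (0 : HomogeneousLocalization.AtPrime 𝒜 x.1.asHomogeneousIdeal.toIdeal).val * f.1 x = 0
    rw [HomogeneousLocalization.val_zero, zero_mul]

/-- The presheaf of abelian groups underlying `𝒪(d)`. -/
def presheafAb (d : ℤ) : TopCat.Presheaf AddCommGrpCat.{u} (Proj 𝒜) where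
  obj U := AddCommGrpCat.of (sections 𝒜 d U.unop)
  map {U V} i := AddCommGrpCat.ofHom
    { toFun := fun f => ⟨fun x => f.1 (i.unop x), (isLocallyFraction 𝒜 d).res i.unop f.1 f.2⟩
      map_zero' := rfl
      map_add' := fun _ _ => rfl }

instance presheafModule (d : ℤ) (U : (Opens (Proj 𝒜))ᵒᵖ) :
    Module ((Proj 𝒜).ringCatSheaf.obj.obj U) ((presheafAb 𝒜 d).obj U) :=
  sectionsModule 𝒜 d U.unop

/-- The twisting sheaf `𝒪(d)` on `Proj 𝒜`, i.e. the sheaf associated with the graded module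
`A(d)`: its sections are locally fractions of degree `d`. -/
noncomputable def twist (d : ℤ) : (Proj 𝒜).Modules where
  val := PresheafOfModules.ofPresheaf (presheafAb 𝒜 d) (fun {U V} i r m => by
    refine Subtype.ext (funext fun x => ?_)
    rfl)
  isSheaf := (TopCat.Presheaf.isSheaf_iff_isSheaf_comp (forget AddCommGrpCat) _).2
    (TopCat.subsheafToTypes (isLocallyFraction 𝒜 d)).2

end ProjTwist

/-! ## Vector bundles and the Grothendieck group -/

namespace AlgebraicGeometry.Scheme

open Limits

variable {X : Scheme.{u}}

/-- The trivial bundle of rank `d`, i.e. the free `𝒪_X`-module of rank `d`. -/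
noncomputable def trivialBundle (X : Scheme.{u}) (d : ℕ) : X.Modules :=
  SheafOfModules.free (R := X.ringCatSheaf) (ULift.{u} (Fin d))

/-- `M` is an algebraic vector bundle of (constant) rank `d`: every point has an open
neighbourhood on which `M` is free of rank `d`. -/
def IsVectorBundleOfRank (M : X.Modules) (d : ℕ) : Prop :=
  ∀ x : X, ∃ U : X.Opens, x ∈ U ∧ Nonempty (M.restrict U.ι ≅ trivialBundle U d)

/-- `M` is an algebraic vector bundle, i.e. locally free of finite rank
(the rank may vary from point to point). -/
def IsVectorBundle (M : X.Modules) : Prop :=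
  ∀ x : X, ∃ U : X.Opens, x ∈ U ∧ ∃ d : ℕ, Nonempty (M.restrict U.ι ≅ trivialBundle U d)

theorem IsVectorBundleOfRank.isVectorBundle {M : X.Modules} {d : ℕ}
    (h : IsVectorBundleOfRank M d) : IsVectorBundle M := fun x => by
  obtain ⟨U, hU, e⟩ := h x
  exact ⟨U, hU, d, e⟩

/-- The structure sheaf as a module over itself. -/
noncomputable def structureModule (X : Scheme.{u}) : X.Modules :=
  SheafOfModules.unit X.ringCatSheaf

theorem isVectorBundleOfRank_structureModule (X : Scheme.{u}) :
    IsVectorBundleOfRank (structureModule X) 1 := fun x => by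
  refine ⟨⊤, trivial, ⟨Modules.restrictUnitIso _ ≪≫ ?_⟩⟩
  exact (coproductUniqueIso (fun _ : ULift.{u} (Fin 1) => 
    SheafOfModules.unit (⊤ : X.Opens).toScheme.ringCatSheaf)).symm

variable (X) in
/-- The relations `[M₂] = [M₁] + [M₃]`, one for every short exact sequence
`0 ⟶ M₁ ⟶ M₂ ⟶ M₃ ⟶ 0` of vector bundles on `X`. -/
def exactRelations : Set (FreeAbelianGroup {M : X.Modules // IsVectorBundle M}) :=
  {z | ∃ (S : ShortComplex X.Modules) (_ : S.ShortExact)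
    (h₁ : IsVectorBundle S.X₁) (h₂ : IsVectorBundle S.X₂) (h₃ : IsVectorBundle S.X₃),
    z = .of ⟨S.X₂, h₂⟩ - .of ⟨S.X₁, h₁⟩ - .of ⟨S.X₃, h₃⟩}

variable (X) in
/-- The Grothendieck group `K⁰(X)` of algebraic vector bundles on `X`. -/
def K0 : Type (u + 1) :=
  FreeAbelianGroup {M : X.Modules // IsVectorBundle M} ⧸
    AddSubgroup.closure (exactRelations X)

instance : AddCommGroup (K0 X) :=
  inferInstanceAs (AddCommGroup (_ ⧸ AddSubgroup.closure (exactRelations X)))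

/-- The class `[M]` of a vector bundle in `K⁰(X)`. -/
def K0.mk (M : X.Modules) (h : IsVectorBundle M) : K0 X :=
  QuotientAddGroup.mk' (AddSubgroup.closure (exactRelations X)) (.of ⟨M, h⟩)

variable (X) in
/-- The unit `1 = [𝒪_X]` of `K⁰(X)`; the integer `n` in `K⁰(X)` is `n • K0.unit X`. -/
noncomputable def K0.unit : K0 X :=
  K0.mk (structureModule X) (isVectorBundleOfRank_structureModule X).isVectorBundle

end AlgebraicGeometry.Scheme

/-! ## Sums-of-squares formulas and the deleted quadric -/

namespace SumsOfSquares

open AlgebraicGeometry MvPolynomial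

attribute [local instance] MvPolynomial.gradedAlgebra

variable (F : Type u) [Field F]

/-- A sums-of-squares formula of type `[r, s, n]` exists over `F`: in the polynomial ring
`F[x₁, …, x_r, y₁, …, y_s]` one has
`(x₁² + ⋯ + x_r²)(y₁² + ⋯ + y_s²) = z₁² + ⋯ + z_n²`
for some bilinear expressions `z_k = ∑ i j, c k i j x_i y_j`. -/
def FormulaExists (r s n : ℕ) : Prop :=
  ∃ c : Fin n → Fin r → Fin s → F,
    ((∑ i, X (Sum.inl i) ^ 2) * (∑ j, X (Sum.inr j) ^ 2) : MvPolynomial (Fin r ⊕ Fin s) F) =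
      ∑ k, (∑ i, ∑ j, C (c k i j) * X (Sum.inl i) * X (Sum.inr j)) ^ 2

/-- The quadratic form `q = y₁² + ⋯ + y_s²`. -/
noncomputable def q (s : ℕ) : MvPolynomial (Fin s) F := ∑ j, X j ^ 2

/-- The projective space `ℙ^{s-1}` over `F`, with homogeneous coordinates `y₁, …, y_s`. -/
noncomputable abbrev projectiveSpace (s : ℕ) : Scheme.{u} :=
  Proj (homogeneousSubmodule (Fin s) F)

/-- The open subscheme `ℙ^{s-1} - V_q`, where `V_q` is the closed subset on which `q`
vanishes. -/
noncomputable def deletedQuadric (s : ℕ) : (projectiveSpace F s).Opens :=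
  Proj.basicOpen (homogeneousSubmodule (Fin s) F) (q F s)

/-- The restriction `ξ` to `ℙ^{s-1} - V_q` of the tautological line bundle `𝒪(-1)`. -/
noncomputable def xi (s : ℕ) : (deletedQuadric F s).toScheme.Modules :=
  (ProjTwist.twist (homogeneousSubmodule (Fin s) F) (-1)).restrict (deletedQuadric F s).ι

end SumsOfSquares

/-! Viewing a formula of type [r,s,n] as a quadratic identity in x with coefficients in F[y] and
polarizing (char F ≠ 2) gives an n × r matrix `l` of linear forms in y with lᵀl = q · 1
(`FormulaExists.exists_orthogonal`). Over the fraction field of F[y] its columns are independent, so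
r ≤ n (`exists_add_eq`).

On X the form q is invertible of degree 2. A linear form l therefore gives two maps, multiplication
by l from ξ to 𝒪 and multiplication by l/q from 𝒪 to ξ, and quadratic identities between linear
forms become identities between composites. The identity lᵀl = q · 1 says that σ : ξʳ ⟶ 𝒪ⁿ, with
entries l, has the left inverse π with entries l/q. So 𝒪ⁿ is the direct sum of ξʳ and ζ = ker π,
which gives the relation in K⁰(X).

It remains to see that ζ is locally free of rank n - r (`exists_complement_bundle`). As ∑ y_j²/q =
1, some m = y_j²/q does not vanish at a given point, and near it y_j/q trivializes ξ. There σ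
becomes a matrix A of functions with AᵀA = m · 1. Its value at the point can be completed by
standard basis vectors to an invertible matrix (`Matrix.exists_complement`). The determinant δ stays
invertible nearby, where the added vectors project isomorphically onto ζ
(`Functor.Additive.isIso_map_complement`). All matrices have entries in the commutative ring `End 𝒪`
of global functions; restriction to an open set is only used, as an additive functor, to invert m
and δ. -/

/-! ### Linear algebra: completing a matrix with orthogonal columns -/

namespace LinearIndependent

/-- A linearly independent family in `κⁿ` can be completed to a basis by standard basis vectors. -/
theorem exists_sumElim_single {κ ι : Type*} [Field κ] [Fintype ι] {n : ℕ}
    {v : ι → Fin n → κ} (hv : LinearIndependent κ v) :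
    ∃ (d : ℕ) (_ : Fintype.card ι + d = n) (f : Fin d → Fin n),
      LinearIndependent κ (Sum.elim v (fun j => Pi.single (f j) (1 : κ))) := by
  classical
  set W := Submodule.span κ (Set.range v)
  -- Standard vectors complete `v` to a basis exactly when their classes form a basis of the
  -- quotient by the span of `v`; such a subfamily is extracted from the spanning classes `w`.
  set w : Fin n → (Fin n → κ) ⧸ W := fun k => W.mkQ (Pi.single k 1)
  obtain ⟨J, a, ha, hspan, hli⟩ := exists_linearIndependent' κ w
  have hw : Submodule.span κ (Set.range w) = ⊤ := by
    have h1 : Set.range w = W.mkQ '' Set.range (fun k : Fin n => (Pi.single k 1 : Fin n → κ)) := by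
      rw [← Set.range_comp]; rfl
    rw [h1, ← Submodule.map_span]
    have h2 : Submodule.span κ (Set.range (fun k : Fin n => (Pi.single k 1 : Fin n → κ))) = ⊤ := by
      have := (Pi.basisFun κ (Fin n)).span_eq
      convert this using 3
      ext k; simp
    rw [h2, Submodule.map_top, Submodule.range_mkQ]
  have : Finite J := Finite.of_injective a ha
  have := Fintype.ofFinite J
  have hcard : Fintype.card J = Module.finrank κ ((Fin n → κ) ⧸ W) := by
    rw [← finrank_span_eq_card hli, hspan, hw, finrank_top]
  have hW : Module.finrank κ W = Fintype.card ι := finrank_span_eq_card hv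
  have htot := Submodule.finrank_quotient_add_finrank W
  rw [Module.finrank_fin_fun, hW, ← hcard] at htot
  let e := Fintype.equivFin J
  refine ⟨Fintype.card J, by omega, fun j => a (e.symm j), ?_⟩
  have hvW : ∀ i, v i ∈ W := fun i => Submodule.subset_span ⟨i, rfl⟩
  have h1 : LinearIndependent κ (fun i => (⟨v i, hvW i⟩ : W)) :=
    LinearIndependent.of_comp W.subtype hv
  exact LinearIndependent.sumElim_of_quotient h1 _
    (hli.comp (fun j => e.symm j) e.symm.injective)

end LinearIndependent

namespace Matrix

/-- If `Aᵀ A` is a scalar not killed by a homomorphism to a field, then `A` can be completed to a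
square matrix with determinant not killed by it. -/
theorem exists_complement {K κ : Type*} [CommRing K] [Field κ] (ev : K →+* κ) {n r : ℕ}
    (A : Matrix (Fin n) (Fin r) K) (m : K) (hm : ev m ≠ 0) (hA : Aᵀ * A = m • 1) :
    ∃ (d : ℕ) (_ : r + d = n) (E : Matrix (Fin n) (Fin d) K) (BQ : Matrix (Fin r) (Fin n) K)
      (BT : Matrix (Fin d) (Fin n) K) (δ : K), ev δ ≠ 0 ∧ A * BQ + E * BT = δ • 1 ∧
        BT * A = 0 ∧ BT * E = δ • 1 := by
  classical
  set A' : Matrix (Fin n) (Fin r) κ := A.map ev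
  have hA' : A'ᵀ * A' = ev m • 1 := by
    have h0 := congrArg (fun M : Matrix (Fin r) (Fin r) K => M.map ev) hA
    simp only [Matrix.map_mul] at h0
    rw [Matrix.map_smul' _ _ _ (map_mul ev), Matrix.map_one _ (map_zero ev) (map_one ev)] at h0
    rw [← h0]; rfl
  -- Over `κ` the scalar `ev m` is invertible, so `A'` has a left inverse up to a unit.
  have hinj : Function.Injective A'.mulVec := by
    intro v w hvw
    have h1 := congrArg (A'ᵀ).mulVec hvw
    simp only [mulVec_mulVec, hA', smul_mulVec, one_mulVec] at h1
    exact smul_right_injective _ hm h1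
  have hli : LinearIndependent κ A'.col := Matrix.mulVec_injective_iff.1 hinj
  obtain ⟨d, hd, f, hf⟩ := hli.exists_sumElim_single
  rw [Fintype.card_fin] at hd
  let e : Fin n ≃ Fin r ⊕ Fin d := (finCongr hd.symm).trans finSumFinEquiv.symm
  -- Standard basis vectors have entries 0 and 1, so the complement found over `κ` lifts to `K`.
  let E : Matrix (Fin n) (Fin d) K := Matrix.of fun k j => (Pi.single (f j) 1 : Fin n → K) k
  let M : Matrix (Fin r ⊕ Fin d) (Fin r ⊕ Fin d) K := (fromCols A E).submatrix e.symm id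
  have hdet : ev M.det ≠ 0 := by
    rw [RingHom.map_det]
    have h1 : LinearIndependent κ (ev.mapMatrix M).col := by
      let eq : (Fin n → κ) ≃ₗ[κ] (Fin r ⊕ Fin d → κ) := LinearEquiv.funCongrLeft κ κ e.symm
      have h2 := hf.map' eq.toLinearMap eq.ker
      have h4 : (ev.mapMatrix M).col = eq.toLinearMap ∘
          Sum.elim A'.col (fun j => Pi.single (f j) (1 : κ)) := by
        funext j i
        rcases j with j | j
        · rfl
        · change ev ((Pi.single (f j) 1 : Fin n → K) (e.symm i)) =
            (Pi.single (f j) 1 : Fin n → κ) (e.symm i)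
          simp [Pi.single_apply, apply_ite ev]
      rw [h4]
      exact h2
    have h3 := (Matrix.linearIndependent_cols_iff_isUnit.1 h1)
    exact ((Matrix.isUnit_iff_isUnit_det _).1 h3).ne_zero
  -- The adjugate inverts `M` up to δ = det M without leaving `K`; its two row blocks are `BQ` and
  -- `BT`.
  let B := M.adjugate.submatrix id e
  have hB1 : fromCols A E * B = M.det • 1 := by
    have := congrArg (fun N => N.submatrix e e) (Matrix.mul_adjugate M)
    simp only [Matrix.submatrix_smul, Pi.smul_apply, Matrix.submatrix_one_equiv] at this
    rw [← this, ← Matrix.submatrix_mul_equiv M _ e (Equiv.refl _) e]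
    congr 1
    ext i j; simp [M]
  have hB2 : B * fromCols A E = M.det • 1 := by
    rw [← Matrix.adjugate_mul M]
    ext i j
    simp only [Matrix.mul_apply, B, M, Matrix.submatrix_apply, id]
    exact Fintype.sum_equiv e _ _ (fun k => by simp)
  refine ⟨d, hd, E, B.submatrix Sum.inl id, B.submatrix Sum.inr id, M.det, hdet, ?_, ?_, ?_⟩
  · rw [← hB1, ← Matrix.fromCols_mul_fromRows]
    congr 1
    ext i j; rcases i with i | i <;> rfl
  · ext i j
    have := congrFun (congrFun hB2 (Sum.inr i)) (Sum.inl j)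
    simpa [Matrix.mul_apply] using this
  · ext i j
    have := congrFun (congrFun hB2 (Sum.inr i)) (Sum.inr j)
    simpa [Matrix.mul_apply, Matrix.one_apply] using this

end Matrix

/-! ### Additive categories: matrices, powers and complements -/

namespace CategoryTheory

open Limits

section Mat

variable {C : Type*} [Category C] [Preadditive C] [HasFiniteBiproducts C]
  {K : Type*} [CommRing K] {O : C} (scal : K →+* End O)

/-- The morphism between powers of `O` given by a matrix. -/
noncomputable def matHom {I J : Type} [Fintype I] [Fintype J] (A : Matrix J I K) :
    (⨁ fun _ : I => O) ⟶ ⨁ fun _ : J => O :=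
  biproduct.matrix fun i j => scal (A j i)

/-- The order is reversed because matrices act on columns, and because multiplication in `End O` is
`≫` read backwards. -/
theorem matHom_comp {I J L : Type} [Fintype I] [Fintype J] [Fintype L] (A : Matrix J I K)
    (B : Matrix L J K) : matHom scal A ≫ matHom scal B = matHom scal (B * A) := by
  classical
  unfold matHom
  ext i l
  have : ∀ x y : K, (scal y : O ⟶ O) ≫ scal x = scal (x * y) := fun x y => by
    rw [map_mul]; rfl
  simp only [biproduct.ι_matrix_assoc, Category.assoc, biproduct.matrix_π, biproduct.lift_desc,
    biproduct.ι_desc, this, Matrix.mul_apply, map_sum]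

theorem matHom_add {I J : Type} [Fintype I] [Fintype J] (A B : Matrix J I K) :
    matHom scal (A + B) = matHom scal A + matHom scal B := by
  unfold matHom
  ext i j
  simp [Preadditive.comp_add, Preadditive.add_comp]

theorem matHom_zero {I J : Type} [Fintype I] [Fintype J] :
    matHom scal (0 : Matrix J I K) = 0 := by
  unfold matHom
  ext i j
  simp

theorem matHom_smul_one {I : Type} [Fintype I] [DecidableEq I] (δ : K) :
    matHom scal (δ • (1 : Matrix I I K)) = biproduct.map fun _ : I => (scal δ : O ⟶ O) := by
  unfold matHom
  ext i j
  rcases eq_or_ne j i with rfl | h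
  · simp
  · simp [Matrix.one_apply_ne h.symm, biproduct.ι_π_ne_assoc _ h]

end Mat

variable {C D : Type*} [Category C] [Category D] [Preadditive C] [Preadditive D]

/-- An additive functor preserves the decomposition `∑ π i ≫ ι i = 𝟙`, so the inverse is assembled
in `D` one summand at a time. -/
theorem Functor.Additive.isIso_map_biproductMap [HasFiniteBiproducts C] (R : C ⥤ D) [R.Additive]
    {I : Type} [Fintype I] {X Y : C} (f : X ⟶ Y) [IsIso (R.map f)] :
    IsIso (R.map (biproduct.map fun _ : I => f)) := by
  classical
  refine ⟨∑ i, R.map (biproduct.π _ i) ≫ CategoryTheory.inv (R.map f) ≫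
    R.map (biproduct.ι (fun _ : I => X) i),
    ?_, ?_⟩
  · rw [Preadditive.comp_sum, ← R.map_id, ← biproduct.total, R.map_sum]
    refine Finset.sum_congr rfl fun i _ => ?_
    rw [← R.map_comp_assoc, biproduct.map_π, R.map_comp, R.map_comp]
    simp
  · rw [Preadditive.sum_comp, ← R.map_id, ← biproduct.total, R.map_sum]
    refine Finset.sum_congr rfl fun i _ => ?_
    rw [Category.assoc, Category.assoc, ← R.map_comp, biproduct.ι_map, R.map_comp, R.map_comp]
    simp

theorem Functor.Additive.nonempty_map_biproduct_iso [HasFiniteBiproducts C]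
    [HasFiniteBiproducts D] (R : C ⥤ D) [R.Additive] {I : Type} [Fintype I] {X : C} {Y : D}
    (e : R.obj X ≅ Y) : Nonempty (R.obj (⨁ fun _ : I => X) ≅ ⨁ fun _ : I => Y) := by
  have := R.preservesFiniteBiproductsOfAdditive
  exact ⟨R.mapBiproduct _ ≪≫ biproduct.mapIso (fun _ => e)⟩

/-- The short complex `Xᵈ ⟶ Xᵈ⁺¹ ⟶ X`. -/
@[simps]
noncomputable def powerShortComplex [HasFiniteBiproducts C] (X : C) (d : ℕ) : ShortComplex C where
  X₁ := ⨁ fun _ : Fin d => X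
  X₂ := ⨁ fun _ : Fin (d + 1) => X
  X₃ := X
  f := biproduct.desc fun i : Fin d => biproduct.ι (fun _ : Fin (d + 1) => X) i.succ
  g := biproduct.π (fun _ : Fin (d + 1) => X) 0
  zero := by
    ext i
    simp [biproduct.ι_π_ne _ (Fin.succ_ne_zero i)]

/-- The complex `Xᵈ ⟶ Xᵈ⁺¹ ⟶ X` splits. -/
noncomputable def powerSplitting [HasFiniteBiproducts C] (X : C) (d : ℕ) :
    (powerShortComplex X d).Splitting where
  r := biproduct.lift fun i : Fin d => biproduct.π (fun _ : Fin (d + 1) => X) i.succ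
  s := biproduct.ι (fun _ : Fin (d + 1) => X) 0
  f_r := by
    have h : (biproduct.desc fun i : Fin d => biproduct.ι (fun _ : Fin (d + 1) => X) i.succ) ≫
        (biproduct.lift fun i : Fin d => biproduct.π (fun _ : Fin (d + 1) => X) i.succ) = 𝟙 _ := by
      ext i j
      rcases eq_or_ne i j with rfl | hij
      · simp
      · simp [biproduct.ι_π_ne _ hij.symm,
          biproduct.ι_π_ne (fun _ : Fin (d + 1) => X) ((Fin.succ_injective _).ne hij.symm)]
    exact h
  s_g := biproduct.ι_π_self _ _
  id := by
    have h : (biproduct.lift fun i : Fin d => biproduct.π (fun _ : Fin (d + 1) => X) i.succ) ≫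
        (biproduct.desc fun i : Fin d => biproduct.ι (fun _ : Fin (d + 1) => X) i.succ) +
        biproduct.π (fun _ : Fin (d + 1) => X) 0 ≫ biproduct.ι (fun _ : Fin (d + 1) => X) 0 =
          𝟙 (⨁ _) := by
      rw [biproduct.lift_desc, ← biproduct.total, Fin.sum_univ_succ]
      exact add_comm _ _
    exact h

/-- Two complements of the same subobject are isomorphic, up to denominators that become
invertible under an additive functor. -/
theorem Functor.Additive.isIso_map_complement [Balanced D] (R : C ⥤ D) [R.Additive]
    {N P Q T Z : C}
    {s : P ⟶ N} {p : N ⟶ P} {i : Z ⟶ N} {t : N ⟶ Z} (hsp : s ≫ p = 𝟙 _) (hit : i ≫ t = 𝟙 _)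
    (htot : t ≫ i + p ≫ s = 𝟙 _)
    {β : Q ⟶ P} {τ : T ⟶ N} {aQ : N ⟶ Q} {aT : N ⟶ T} {δN : N ⟶ N} {δT : T ⟶ T}
    (h₁ : aQ ≫ β ≫ s + aT ≫ τ = δN) (h₂ : (β ≫ s) ≫ aT = 0) (h₃ : τ ≫ aT = δT)
    [Epi (R.map β)] [Epi (R.map δN)] [Mono (R.map δT)] : IsIso (R.map (τ ≫ t)) := by
  -- Inserting `htot` between `s` and `t` gives `s ≫ t + s ≫ t = s ≫ t`.
  have hst : s ≫ t = 0 := by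
    have h4 : s ≫ (t ≫ i + p ≫ s) ≫ t = s ≫ t := by rw [htot, Category.id_comp]
    simpa [Preadditive.add_comp, Preadditive.comp_add, hit, reassoc_of% hsp] using h4
  -- In `C` only `β ≫ s` is known to be killed by `aT`; `β` can be cancelled after applying `R`.
  have hsa : R.map (s ≫ aT) = 0 := by
    rw [← cancel_epi (R.map β), ← R.map_comp, ← Category.assoc, h₂, R.map_zero, comp_zero]
  -- Since `t ≫ i = 𝟙 - p ≫ s` and `s ≫ aT` dies under `R`, following `τ ≫ t` by `i ≫ aT` gives
  -- `δT`.
  have hmono : Mono (R.map (τ ≫ t)) := by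
    have h5 : R.map (τ ≫ t) ≫ R.map (i ≫ aT) = R.map δT := by
      have h6 : t ≫ i = 𝟙 _ - p ≫ s := by rw [← htot]; abel
      rw [← R.map_comp, Category.assoc, reassoc_of% h6, Preadditive.sub_comp,
        Preadditive.comp_sub, R.map_sub, Category.id_comp, h₃, Category.assoc, R.map_comp τ,
        R.map_comp p, hsa]
      simp
    have : Mono (R.map (τ ≫ t) ≫ R.map (i ≫ aT)) := by rw [h5]; infer_instance
    exact mono_of_mono _ (R.map (i ≫ aT))
  -- Since `s ≫ t = 0`, composing `h₁` with `t` gives `aT ≫ τ ≫ t = δN ≫ t`, and `t` is split epi.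
  have hepi : Epi (R.map (τ ≫ t)) := by
    have h5 : R.map aT ≫ R.map (τ ≫ t) = R.map δN ≫ R.map t := by
      rw [← R.map_comp, ← R.map_comp, ← h₁, Preadditive.add_comp]
      simp [hst]
    have : IsSplitEpi (R.map t) := ⟨⟨⟨R.map i, by rw [← R.map_comp, hit, R.map_id]⟩⟩⟩
    have : Epi (R.map aT ≫ R.map (τ ≫ t)) := by rw [h5]; infer_instance
    exact epi_of_epi (R.map aT) _
  exact isIso_of_mono_of_epi _

end CategoryTheory

/-! ### Multiplication morphisms between 𝒪 and 𝒪(d) -/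

namespace AlgebraicGeometry.Scheme.Modules

/-- A morphism of sheaves of modules from compatible linear maps on sections. -/
noncomputable def homMk {X : Scheme.{u}} {M N : X.Modules}
    (φ : ∀ U : X.Opens, Γ(M, U) →+ Γ(N, U))
    (hres : ∀ {U V : X.Opens} (i : V ⟶ U) (m : Γ(M, U)),
      φ V (M.presheaf.map i.op m) = N.presheaf.map i.op (φ U m))
    (hsmul : ∀ (U : X.Opens) (r : Γ(X, U)) (m : Γ(M, U)), φ U (r • m) = r • φ U m) : M ⟶ N :=
  SheafOfModules.Hom.mk (PresheafOfModules.homMk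
    { app := fun U => AddCommGrpCat.ofHom (φ U.unop)
      naturality := fun U V i => by
        ext m
        exact hres i.unop m }
    (fun U r m => hsmul U.unop r m))

end AlgebraicGeometry.Scheme.Modules

namespace ProjTwist

open AlgebraicGeometry

variable {A : Type u} {σ : Type u} [CommRing A] [SetLike σ A] [AddSubgroupClass σ A]
variable {𝒜 : ℕ → σ} [GradedRing 𝒜]

theorem isLocallyFraction_mul {d e c : ℤ} (h : d + e = c) {U : Opens (ProjectiveSpectrum.top 𝒜)}
    {f g : ∀ x : U, Stalk 𝒜 x.1}
    (hf : (isLocallyFraction 𝒜 d).pred f) (hg : (isLocallyFraction 𝒜 e).pred g) :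
    (isLocallyFraction 𝒜 c).pred (fun x => f x * g x) := fun x => by
  obtain ⟨V, mV, iV, i, j, hij, a, b, hb, w⟩ := hf x
  obtain ⟨W, mW, iW, k, l, hkl, a', b', hb', w'⟩ := hg x
  refine ⟨V ⊓ W, ⟨mV, mW⟩, Opens.infLELeft _ _ ≫ iV, i + k, j + l, by push_cast; omega,
    ⟨a.1 * a'.1, SetLike.mul_mem_graded a.2 a'.2⟩, ⟨b.1 * b'.1, SetLike.mul_mem_graded b.2 b'.2⟩,
    fun y h => (ProjectiveSpectrum.isPrime y.1).mem_or_mem h |>.elim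
      (hb ⟨y.1, y.2.1⟩) (hb' ⟨y.1, y.2.2⟩), ?_⟩
  rintro ⟨y, hy⟩
  have h1 := w ⟨y, hy.1⟩
  have h2 := w' ⟨y, hy.2⟩
  change f (iV ⟨y, hy.1⟩) * g (iW ⟨y, hy.2⟩) = _
  refine (congrArg₂ (· * ·) h1 h2).trans ?_
  rw [Localization.mk_mul]
  rfl

/-- A function that is locally a fraction of degree `0` is a section of the structure sheaf. -/
theorem exists_val_eq {U : Opens (ProjectiveSpectrum.top 𝒜)} {f : ∀ x : U, Stalk 𝒜 x.1}
    (hf : (isLocallyFraction 𝒜 0).pred f) :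
    ∃ r : (ProjectiveSpectrum.Proj.structureSheaf 𝒜).1.obj (op U),
      ∀ x : U, (r.1 x).val = f x := by
  have hp : ∀ x : ProjectiveSpectrum.top 𝒜, x.asHomogeneousIdeal.toIdeal.IsPrime :=
    fun x => ProjectiveSpectrum.isPrime x
  have h1 : ∀ x : U, ∃ s : HomogeneousLocalization.AtPrime 𝒜 x.1.asHomogeneousIdeal.toIdeal,
      s.val = f x := fun x => by
    obtain ⟨V, mV, iV, i, j, hij, a, b, hb, w⟩ := hf x
    obtain rfl : i = j := by omega
    refine ⟨.mk (𝒜 := 𝒜) (x := x.1.asHomogeneousIdeal.toIdeal.primeCompl)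
      ⟨i, a, b, hb ⟨x.1, mV⟩⟩, ?_⟩
    rw [HomogeneousLocalization.val_mk]
    exact (w ⟨x.1, mV⟩).symm
  choose s hs using h1
  refine ⟨⟨s, fun x => ?_⟩, hs⟩
  obtain ⟨V, mV, iV, i, j, hij, a, b, hb, w⟩ := hf x
  obtain rfl : i = j := by omega
  refine ⟨V, mV, iV, i, a, b, hb, fun y => ?_⟩
  apply HomogeneousLocalization.val_injective
  rw [HomogeneousLocalization.val_mk]
  exact (hs _).trans (w y)

/-- The section of the structure sheaf given by a function that is locally a fraction of
degree `0`. -/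
noncomputable def contract {U : Opens (ProjectiveSpectrum.top 𝒜)} (f : ∀ x : U, Stalk 𝒜 x.1)
    (hf : (isLocallyFraction 𝒜 0).pred f) :
    (ProjectiveSpectrum.Proj.structureSheaf 𝒜).1.obj (op U) :=
  (exists_val_eq hf).choose

theorem contract_val {U : Opens (ProjectiveSpectrum.top 𝒜)} {f : ∀ x : U, Stalk 𝒜 x.1}
    (hf : (isLocallyFraction 𝒜 0).pred f) (x : U) : ((contract f hf).1 x).val = f x :=
  (exists_val_eq hf).choose_spec x

theorem structureSheaf_ext {U : Opens (ProjectiveSpectrum.top 𝒜)}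
    {r s : (ProjectiveSpectrum.Proj.structureSheaf 𝒜).1.obj (op U)}
    (h : ∀ x : U, (r.1 x).val = (s.1 x).val) : r = s :=
  Subtype.ext (funext fun x => HomogeneousLocalization.val_injective _ (h x))

section

variable {d e : ℤ} (h : d + e = 0) {U W : Opens (ProjectiveSpectrum.top 𝒜)} (hW : W ≤ U)
  (g : sections 𝒜 d U)

/-- Restriction of sections of `𝒪(d)`. -/
def sectionsRes : sections 𝒜 d W :=
  ⟨fun x => g.1 ⟨x.1, hW x.2⟩, (isLocallyFraction 𝒜 d).res (homOfLE hW) g.1 g.2⟩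

/-- The product of sections of `𝒪(d)` and `𝒪(-d)`, as a section of the structure sheaf. -/
noncomputable def mulContract :
    sections 𝒜 e W →+ (ProjectiveSpectrum.Proj.structureSheaf 𝒜).1.obj (op W) where
  toFun f := contract _ (isLocallyFraction_mul h (sectionsRes hW g).2 f.2)
  map_zero' := structureSheaf_ext fun x => by
    have hp := ProjectiveSpectrum.isPrime x.1
    rw [contract_val]
    exact (mul_zero _).trans (HomogeneousLocalization.val_zero).symm
  map_add' f f' := structureSheaf_ext fun x => by
    have hp := ProjectiveSpectrum.isPrime x.1
    rw [contract_val]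
    refine (mul_add _ _ _).trans ?_
    refine Eq.trans ?_ (HomogeneousLocalization.val_add _ _).symm
    exact congrArg₂ (· + ·)
      (contract_val (isLocallyFraction_mul h (sectionsRes hW g).2 f.2) x).symm
      (contract_val (isLocallyFraction_mul h (sectionsRes hW g).2 f'.2) x).symm

theorem mulContract_val (f : sections 𝒜 e W) (x : W) :
    ((mulContract h hW g f).1 x).val = g.1 ⟨x.1, hW x.2⟩ * f.1 x :=
  contract_val (isLocallyFraction_mul h (sectionsRes hW g).2 f.2) x

theorem mulContract_smul (r : (ProjectiveSpectrum.Proj.structureSheaf 𝒜).1.obj (op W))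
    (f : sections 𝒜 e W) : mulContract h hW g (r • f) = r * mulContract h hW g f :=
  structureSheaf_ext fun x => by
    have hp := ProjectiveSpectrum.isPrime x.1
    refine (mulContract_val _ _ _ _ x).trans ?_
    refine Eq.trans ?_ (HomogeneousLocalization.val_mul _ _).symm
    refine Eq.trans ?_ (congrArg₂ (· * ·) rfl (mulContract_val _ _ _ _ x).symm)
    exact mul_left_comm _ _ _

/-- The product of a section of the structure sheaf with a section of `𝒪(d)`. -/
noncomputable def smulSection :
    (ProjectiveSpectrum.Proj.structureSheaf 𝒜).1.obj (op W) →+ sections 𝒜 d W where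
  toFun r := r • sectionsRes hW g
  map_zero' := zero_smul _ _
  map_add' r s := add_smul r s _

end

variable (U : (Proj 𝒜).Opens)

theorem image_ι_le (W : U.toScheme.Opens) : U.ι ''ᵁ W ≤ U := by
  rintro _ ⟨y, -, rfl⟩
  exact y.2

/-- The restricted sheaf carries the action transported along `U.ι.appIso`, which is an identity;
linearity can thus be checked on `Proj` itself. -/
theorem restrict_ι_smul {X : Scheme.{u}} {M : X.Modules} (U : X.Opens) {W : U.toScheme.Opens}
    (r : Γ(X, U.ι ''ᵁ W)) (f : Γ(M, U.ι ''ᵁ W)) :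
    HSMul.hSMul (α := Γ(U.toScheme, W)) (β := Γ(M.restrict U.ι, W)) r f = r • f := by
  change (U.ι.appIso W).inv r • f = r • f
  rw [Scheme.Opens.ι_appIso]
  rfl

/-- Multiplication by a section of `𝒪(d)` over `U`, from `𝒪(e)` to `𝒪`, when `d + e = 0`. -/
noncomputable def mulToUnit {d e : ℤ} (h : d + e = 0) (g : sections 𝒜 d U) :
    (twist 𝒜 e).restrict U.ι ⟶ Scheme.structureModule U.toScheme :=
  Scheme.Modules.homMk
    (fun W => (mulContract h (image_ι_le U W) g :))
    (fun {V W} i m => structureSheaf_ext fun x =>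
      (mulContract_val h (image_ι_le U W) g _ x).trans
        (mulContract_val h (image_ι_le U V) g m (U.ι.opensFunctor.map i x)).symm)
    (fun W r f => (congrArg (mulContract h (image_ι_le U W) g) (restrict_ι_smul U r f)).trans
      (mulContract_smul h (image_ι_le U W) g r f))

/-- Multiplication by a section of `𝒪(d)` over `U`, from `𝒪` to `𝒪(d)`. -/
noncomputable def mulFromUnit {d : ℤ} (g : sections 𝒜 d U) :
    Scheme.structureModule U.toScheme ⟶ (twist 𝒜 d).restrict U.ι :=
  Scheme.Modules.homMk
    (fun W => (smulSection (image_ι_le U W) g :))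
    (fun {V W} i m => rfl)
    (fun W r f => by
      refine Eq.trans ?_ (restrict_ι_smul (M := twist 𝒜 d) U r (smulSection (image_ι_le U W) g f)).symm
      exact (sectionsModule 𝒜 d (U.ι ''ᵁ W)).mul_smul r f (sectionsRes (image_ι_le U W) g))

section

variable {U} {d e : ℤ} (h : d + e = 0)

/-- The value at a point of the image of a section under a morphism to `𝒪`. -/
noncomputable def evalUnit {M : U.toScheme.Modules} (W : U.toScheme.Opens) (m : Γ(M, W))
    (x : (U.ι ''ᵁ W : Opens (ProjectiveSpectrum.top 𝒜))) :
    (M ⟶ Scheme.structureModule U.toScheme) →+ Stalk 𝒜 x.1 :=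
  AddMonoidHom.mk' (fun φ => ((show (ProjectiveSpectrum.Proj.structureSheaf 𝒜).1.obj
    (op (U.ι ''ᵁ W)) from φ.app W m).1 x).val) fun φ ψ => by
      have hp := ProjectiveSpectrum.isPrime x.1
      exact HomogeneousLocalization.val_add _ _

/-- The value at a point of the image of a section under a morphism to `𝒪(d)`. -/
noncomputable def evalTwist {M : U.toScheme.Modules} (W : U.toScheme.Opens) (m : Γ(M, W))
    (x : (U.ι ''ᵁ W : Opens (ProjectiveSpectrum.top 𝒜))) :
    (M ⟶ (twist 𝒜 d).restrict U.ι) →+ Stalk 𝒜 x.1 :=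
  AddMonoidHom.mk' (fun φ => (show sections 𝒜 d (U.ι ''ᵁ W) from φ.app W m).1 x) fun _ _ => rfl

/-- Sections of 𝒪 are determined by their values in the localizations, so equality of morphisms
reduces to identities between fractions. -/
theorem hom_toUnit_ext {M : U.toScheme.Modules} {φ ψ : M ⟶ Scheme.structureModule U.toScheme}
    (H : ∀ (W : U.toScheme.Opens) (m : Γ(M, W))
      (x : (U.ι ''ᵁ W : Opens (ProjectiveSpectrum.top 𝒜))),
      evalUnit W m x φ = evalUnit W m x ψ) : φ = ψ := by
  ext W m
  exact structureSheaf_ext (H W m)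

theorem hom_toTwist_ext {M : U.toScheme.Modules} {φ ψ : M ⟶ (twist 𝒜 d).restrict U.ι}
    (H : ∀ (W : U.toScheme.Opens) (m : Γ(M, W))
      (x : (U.ι ''ᵁ W : Opens (ProjectiveSpectrum.top 𝒜))),
      evalTwist W m x φ = evalTwist W m x ψ) : φ = ψ := by
  ext W m
  exact Subtype.ext (funext (H W m))

/-- The factor at `𝟙 _` is the value of `r`; written this way, additivity of `evalUnit` turns sums
of composites into sums of products `g * f`. -/
theorem evalUnit_mulFromUnit_mulToUnit (g : sections 𝒜 d U) (f : sections 𝒜 e U)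
    (W : U.toScheme.Opens) (r : Γ(Scheme.structureModule U.toScheme, W))
    (x : (U.ι ''ᵁ W : Opens (ProjectiveSpectrum.top 𝒜))) :
    evalUnit W r x (mulFromUnit U f ≫ mulToUnit U h g) =
      (g.1 ⟨x.1, image_ι_le U W x.2⟩ * f.1 ⟨x.1, image_ι_le U W x.2⟩) *
        evalUnit W r x (𝟙 _) := by
  refine (mulContract_val h (image_ι_le U W) g _ x).trans ?_
  refine (mul_left_comm _ _ _).trans ?_
  exact mul_comm _ _

theorem evalTwist_mulToUnit_mulFromUnit (g : sections 𝒜 d U) (f : sections 𝒜 e U)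
    (W : U.toScheme.Opens) (m : Γ((twist 𝒜 e).restrict U.ι, W))
    (x : (U.ι ''ᵁ W : Opens (ProjectiveSpectrum.top 𝒜))) :
    evalTwist W m x (mulToUnit U h g ≫ mulFromUnit U f) =
      (g.1 ⟨x.1, image_ι_le U W x.2⟩ * f.1 ⟨x.1, image_ι_le U W x.2⟩) *
        evalTwist W m x (𝟙 _) := by
  refine (congrArg₂ (· * ·) (mulContract_val h (image_ι_le U W) g m x) rfl).trans ?_
  exact mul_right_comm _ _ _

theorem mulFromUnit_mulToUnit_congr {g g' : sections 𝒜 d U} {f f' : sections 𝒜 e U}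
    (H : ∀ x, g.1 x * f.1 x = g'.1 x * f'.1 x) :
    mulFromUnit U f ≫ mulToUnit U h g = mulFromUnit U f' ≫ mulToUnit U h g' :=
  hom_toUnit_ext fun W r x => by
    rw [evalUnit_mulFromUnit_mulToUnit, evalUnit_mulFromUnit_mulToUnit, H]

theorem mulToUnit_mulFromUnit_congr {g g' : sections 𝒜 d U} {f f' : sections 𝒜 e U}
    (H : ∀ x, g.1 x * f.1 x = g'.1 x * f'.1 x) :
    mulToUnit U h g ≫ mulFromUnit U f = mulToUnit U h g' ≫ mulFromUnit U f' :=
  hom_toTwist_ext fun W m x => by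
    rw [evalTwist_mulToUnit_mulFromUnit, evalTwist_mulToUnit_mulFromUnit, H]

theorem sum_mulFromUnit_mulToUnit {ι : Type} [Fintype ι] (g : ι → sections 𝒜 d U)
    (f : ι → sections 𝒜 e U) (H : ∀ x, ∑ i, (g i).1 x * (f i).1 x = 1) :
    ∑ i, mulFromUnit U (f i) ≫ mulToUnit U h (g i) = 𝟙 _ :=
  hom_toUnit_ext fun W r x => by
    rw [map_sum]
    simp only [evalUnit_mulFromUnit_mulToUnit]
    rw [← Finset.sum_mul, H, one_mul]

theorem sum_mulToUnit_mulFromUnit {ι : Type} [Fintype ι] (g : ι → sections 𝒜 d U)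
    (f : ι → sections 𝒜 e U) (H : ∀ x, ∑ i, (g i).1 x * (f i).1 x = 1) :
    ∑ i, mulToUnit U h (g i) ≫ mulFromUnit U (f i) = 𝟙 _ :=
  hom_toTwist_ext fun W m x => by
    rw [map_sum]
    simp only [evalTwist_mulToUnit_mulFromUnit]
    rw [← Finset.sum_mul, H, one_mul]

theorem sum_mulToUnit_mulFromUnit_eq_zero {ι : Type} [Fintype ι] (g : ι → sections 𝒜 d U)
    (f : ι → sections 𝒜 e U) (H : ∀ x, ∑ i, (g i).1 x * (f i).1 x = 0) :
    ∑ i, mulToUnit U h (g i) ≫ mulFromUnit U (f i) = 0 :=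
  hom_toTwist_ext fun W m x => by
    rw [map_sum]
    simp only [evalTwist_mulToUnit_mulFromUnit]
    rw [← Finset.sum_mul, H, zero_mul, map_zero]

end

end ProjTwist

/-! ### Endomorphisms of 𝒪, line bundles and classes in K⁰ -/

namespace AlgebraicGeometry.Scheme

open Limits

variable {X : Scheme.{u}}

instance : HasFiniteBiproducts X.Modules := Abelian.hasFiniteBiproducts

instance (V : X.Opens) : (Modules.restrictFunctor V.ι).Additive :=
  have := preservesBinaryBiproducts_of_preservesBinaryCoproducts (Modules.restrictFunctor V.ι)
  Functor.additive_of_preservesBinaryBiproducts _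

/-- The global section `e(1)` of an endomorphism `e` of `𝒪`. -/
noncomputable def endSection (e : structureModule X ⟶ structureModule X) : Γ(X, ⊤) :=
  e.app ⊤ (1 : Γ(X, ⊤))

/-- By linearity and naturality, since `1` generates 𝒪 and is the restriction of the global `1`. -/
theorem end_app_apply (e : structureModule X ⟶ structureModule X) (U : X.Opens) (t : Γ(X, U)) :
    e.app U t = t * X.presheaf.map (homOfLE le_top).op (endSection e) := by
  have h1 : e.app U (1 : Γ(X, U)) = X.presheaf.map (homOfLE le_top).op (endSection e) := by
    have := CategoryTheory.congr_fun (e.mapPresheaf.naturality (homOfLE (le_top : U ≤ ⊤)).op)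
      (1 : Γ(X, ⊤))
    refine Eq.trans ?_ this
    exact congrArg (e.app U) (map_one (X.presheaf.map (homOfLE le_top).op).hom).symm
  have h2 := e.app_smul (U := U) t (1 : Γ(X, U))
  rw [← h1]
  refine Eq.trans (congrArg (e.app U) ?_) h2
  exact (mul_one t).symm

theorem end_top_apply (e : structureModule X ⟶ structureModule X) (t : Γ(X, ⊤)) :
    e.app ⊤ t = t * endSection e := by
  refine (end_app_apply e ⊤ t).trans ?_
  rw [show (homOfLE le_top : (⊤ : X.Opens) ⟶ ⊤).op = 𝟙 _ from rfl, X.presheaf.map_id]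
  rfl

theorem end_comm (e f : structureModule X ⟶ structureModule X) : e ≫ f = f ≫ e := by
  ext U t
  let F : ∀ e : structureModule X ⟶ structureModule X, Γ(X, U) := fun e =>
    X.presheaf.map (homOfLE le_top).op (endSection e)
  have h1 : ∀ e f : structureModule X ⟶ structureModule X,
      (e ≫ f).app U t = (show Γ(X, U) from t) * F e * F f := fun e f =>
    (end_app_apply f U _).trans (congrArg (fun z : Γ(X, U) => z * F f) (end_app_apply e U t))
  rw [h1, h1]
  exact mul_right_comm (show Γ(X, U) from t) (F e) (F f)

variable (X) in
/-- Endomorphisms of `𝒪` commute. -/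
noncomputable abbrev endCommRing : CommRing (End (structureModule X)) :=
  { (inferInstance : Ring (End (structureModule X))) with
    mul_comm := fun e f => end_comm f e }

attribute [local instance] endCommRing

/-- The value of an endomorphism of `𝒪` at a point. -/
noncomputable def endEval (x : X) : End (structureModule X) →+* X.residueField x :=
  (X.evaluation ⊤ x trivial).hom.comp
    { toFun := fun e => endSection e
      map_one' := rfl
      map_zero' := rfl
      map_add' := fun _ _ => rfl
      map_mul' := fun e f => (end_top_apply e (endSection f)).trans (mul_comm (endSection f) _) }

/-- The open set is the basic open of the function `e(1)`: it contains `x`, and over it `e` is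
multiplication by a unit. -/
theorem exists_isIso_restrict {x : X} {e : structureModule X ⟶ structureModule X}
    (he : endEval x e ≠ 0) :
    ∃ V : X.Opens, x ∈ V ∧ IsIso ((Modules.restrictFunctor V.ι).map e) := by
  refine ⟨X.basicOpen (endSection e), ?_, ?_⟩
  · exact (X.evaluation_ne_zero_iff_mem_basicOpen x (U := ⊤) trivial _).1 he
  · rw [Modules.Hom.isIso_iff_isIso_app]
    intro W
    rw [ConcreteCategory.isIso_iff_bijective]
    let V : X.Opens := X.basicOpen (endSection e)
    let W' : X.Opens := V.ι ''ᵁ W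
    have hW : W' ≤ V := by
      rintro _ ⟨y, -, rfl⟩
      exact y.2
    have hu : IsUnit (X.presheaf.map (homOfLE (le_top : W' ≤ ⊤)).op (endSection e)) := by
      have h1 : IsUnit (X.presheaf.map (homOfLE (le_top : V ≤ ⊤)).op (endSection e)) :=
        RingedSpace.isUnit_res_basicOpen X.toRingedSpace (endSection e)
      have h2 := h1.map (X.presheaf.map (homOfLE hW).op).hom
      rwa [← CommRingCat.comp_apply, ← X.presheaf.map_comp] at h2
    have h3 : Function.Bijective (fun t : Γ(X, W') => e.app W' t) := by
      have h4 : (fun t : Γ(X, W') => e.app W' t) = fun t => t *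
          X.presheaf.map (homOfLE (le_top : W' ≤ ⊤)).op (endSection e) :=
        funext fun t => end_app_apply e W' t
      rw [h4]
      exact IsUnit.isUnit_iff_mulRight_bijective.1 hu
    exact h3

/-- The trivial bundle as a biproduct. -/
noncomputable def trivialBundleIso (X : Scheme.{u}) (d : ℕ) :
    (⨁ fun _ : Fin d => structureModule X) ≅ trivialBundle X d :=
  biproduct.isoCoproduct _ ≪≫ Sigma.whiskerEquiv (J := Fin d) (K := ULift.{u} (Fin d))
    (f := fun _ => structureModule X) (g := fun _ => structureModule X) Equiv.ulift.symm
    (fun _ => Iso.refl _)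

/-- `M` is free of rank one on `V`. -/
def TrivialOn (M : X.Modules) (V : X.Opens) : Prop :=
  Nonempty (M.restrict V.ι ≅ structureModule V.toScheme)

theorem trivialOn_structureModule (V : X.Opens) : TrivialOn (structureModule X) V :=
  ⟨Modules.restrictUnitIso _⟩

theorem TrivialOn.biproduct {M : X.Modules} {V : X.Opens} (h : TrivialOn M V) (d : ℕ) :
    Nonempty ((⨁ fun _ : Fin d => M).restrict V.ι ≅ trivialBundle V d) := by
  obtain ⟨e⟩ := h
  obtain ⟨i⟩ := Functor.Additive.nonempty_map_biproduct_iso (I := Fin d)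
    (Modules.restrictFunctor V.ι) e
  exact ⟨i ≪≫ trivialBundleIso V d⟩

/-- `M` is locally free of rank one. -/
def IsLineBundle (M : X.Modules) : Prop := ∀ x : X, ∃ V : X.Opens, x ∈ V ∧ TrivialOn M V

theorem isLineBundle_structureModule : IsLineBundle (structureModule X) :=
  fun _ => ⟨⊤, trivial, trivialOn_structureModule _⟩

theorem IsLineBundle.biproduct {M : X.Modules} (h : IsLineBundle M) (d : ℕ) :
    IsVectorBundleOfRank (⨁ fun _ : Fin d => M) d := fun x => by
  obtain ⟨V, hx, hV⟩ := h x
  exact ⟨V, hx, hV.biproduct d⟩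

theorem IsLineBundle.isVectorBundleOfRank {M : X.Modules} (h : IsLineBundle M) :
    IsVectorBundleOfRank M 1 := fun x => by
  obtain ⟨V, hx, ⟨e⟩⟩ := h x
  exact ⟨V, hx, ⟨e ≪≫ (biproductUniqueIso (fun _ : Fin 1 => structureModule V.toScheme)).symm ≪≫
    trivialBundleIso V 1⟩⟩

theorem K0.mk_eq_add {S : ShortComplex X.Modules} (hS : S.ShortExact)
    (h₁ : IsVectorBundle S.X₁) (h₂ : IsVectorBundle S.X₂) (h₃ : IsVectorBundle S.X₃) :
    K0.mk S.X₂ h₂ = K0.mk S.X₁ h₁ + K0.mk S.X₃ h₃ := by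
  let p := QuotientAddGroup.mk' (AddSubgroup.closure (exactRelations X))
  change p _ = p _ + p _
  rw [← map_add, ← sub_eq_zero, ← map_sub, ← sub_sub]
  exact (QuotientAddGroup.eq_zero_iff _).2 (AddSubgroup.subset_closure ⟨S, hS, h₁, h₂, h₃, rfl⟩)

theorem K0.mk_biproduct {M : X.Modules} (h : IsLineBundle M) (d : ℕ) :
    K0.mk (⨁ fun _ : Fin d => M) (h.biproduct d).isVectorBundle =
      d • K0.mk M h.isVectorBundleOfRank.isVectorBundle := by
  induction d with
  | zero =>
    let Z : X.Modules := ⨁ fun _ : Fin 0 => M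
    have hz : 𝟙 Z = 0 := by
      rw [← biproduct.total]; simp
    -- As `Z` is zero, Z ⟶ Z ⟶ Z is short exact, so [Z] = [Z] + [Z].
    let S : ShortComplex X.Modules := ShortComplex.mk (𝟙 Z) (0 : Z ⟶ Z) (by simp)
    have hS : S.Splitting :=
      { r := 𝟙 _, s := 0, f_r := by simp [S], s_g := by simp [S, hz], id := by simp [S] }
    have hv : IsVectorBundle Z := (h.biproduct 0).isVectorBundle
    have := K0.mk_eq_add hS.shortExact hv hv hv
    rw [zero_smul]
    exact left_eq_add.1 this
  | succ d ih =>
    have := K0.mk_eq_add (powerSplitting M d).shortExact (h.biproduct d).isVectorBundle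
      (h.biproduct (d + 1)).isVectorBundle h.isVectorBundleOfRank.isVectorBundle
    rw [succ_nsmul, ← ih]
    exact this

end AlgebraicGeometry.Scheme

/-! ### The complement of an orthogonal embedding ξʳ ⟶ 𝒪ⁿ -/

namespace AlgebraicGeometry.Scheme

open Limits

attribute [local instance] endCommRing

variable {X : Scheme.{u}} {ξ : X.Modules} {s : ℕ} {a : Fin s → (ξ ⟶ structureModule X)}
  {b : Fin s → (structureModule X ⟶ ξ)}

/-- The values at `x` sum to 1. In the application `b j ≫ a j` is the function y_j²/q. -/
theorem exists_endEval_ne_zero (hba : ∑ j, b j ≫ a j = 𝟙 _) (x : X) :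
    ∃ j, endEval x (b j ≫ a j) ≠ 0 := by
  by_contra! H
  have h1 : endEval x (∑ j, b j ≫ a j) = 1 := by
    rw [hba]
    exact map_one (endEval x)
  have h2 : endEval x (∑ j, b j ≫ a j) = 0 :=
    (map_sum (endEval x) (fun j => (b j ≫ a j : End (structureModule X))) _).trans
      (Finset.sum_eq_zero fun j _ => H j)
  exact one_ne_zero (h1.symm.trans h2)

/-- If `ξ` is the image of a symmetric rank one projector on `𝒪ˢ`, a coordinate trivializes `ξ`
where the corresponding diagonal entry is invertible. -/
theorem isIso_restrict_coordinate (hab : ∑ j, a j ≫ b j = 𝟙 _)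
    (hcomm : ∀ i j, a i ≫ b j = a j ≫ b i) (j : Fin s) {D : Type*} [Category D] [Preadditive D]
    [Balanced D] (R : X.Modules ⥤ D) [R.Additive] [IsIso (R.map (b j ≫ a j))] :
    IsIso (R.map (b j)) := by
  have hm : Mono (R.map (b j)) := by
    have : Mono (R.map (b j) ≫ R.map (a j)) := by rw [← R.map_comp]; infer_instance
    exact mono_of_mono _ (R.map (a j))
  have he : Epi (R.map (b j)) := by
    -- By symmetry `b j ≫ a j ≫ b k = b j ≫ a k ≫ b j`, so if `ψ` is killed by `b j` it is killed by
    -- every `b k`, hence by `𝟙 = ∑ a k ≫ b k`.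
    refine Preadditive.epi_of_cancel_zero _ fun {T} ψ hψ => ?_
    have hk : ∀ k, R.map (b k) ≫ ψ = 0 := fun k => by
      rw [← cancel_epi (R.map (b j ≫ a j)), ← Category.assoc, ← R.map_comp, Category.assoc,
        hcomm j k, ← Category.assoc, R.map_comp, Category.assoc, hψ, comp_zero, comp_zero]
    rw [← Category.id_comp ψ, ← R.map_id, ← hab, R.map_sum, Preadditive.sum_comp]
    exact Finset.sum_eq_zero fun k _ => by rw [R.map_comp, Category.assoc, hk, comp_zero]
  exact isIso_of_mono_of_epi _

theorem isLineBundle_of_projector (hab : ∑ j, a j ≫ b j = 𝟙 _) (hba : ∑ j, b j ≫ a j = 𝟙 _)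
    (hcomm : ∀ i j, a i ≫ b j = a j ≫ b i) : IsLineBundle ξ := fun x => by
  obtain ⟨j, hj⟩ := exists_endEval_ne_zero hba x
  obtain ⟨V, hx, hV⟩ := exists_isIso_restrict hj
  have := isIso_restrict_coordinate hab hcomm j (Modules.restrictFunctor V.ι)
  exact ⟨V, hx, ⟨(asIso ((Modules.restrictFunctor V.ι).map (b j))).symm ≪≫
    Modules.restrictUnitIso _⟩⟩

/-- An orthogonal embedding `ξʳ ⟶ 𝒪ⁿ` has a locally free complement. -/
theorem exists_complement_bundle (hab : ∑ j, a j ≫ b j = 𝟙 _) (hba : ∑ j, b j ≫ a j = 𝟙 _)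
    (hcomm : ∀ i j, a i ≫ b j = a j ≫ b i) {r n : ℕ}
    {α : Fin n → Fin r → (ξ ⟶ structureModule X)} {β : Fin n → Fin r → (structureModule X ⟶ ξ)}
    (hαβ : ∀ i i', ∑ k, α k i ≫ β k i' = if i = i' then 𝟙 _ else 0)
    (hcomm' : ∀ j k i, b j ≫ α k i = β k i ≫ a j) {d : ℕ} (hd : r + d = n) :
    ∃ (ζ : X.Modules) (hζ : IsVectorBundleOfRank ζ d),
      r • K0.mk ξ (isLineBundle_of_projector hab hba hcomm).isVectorBundleOfRank.isVectorBundle +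
        K0.mk ζ hζ.isVectorBundle = n • K0.unit X := by
  have hξ := isLineBundle_of_projector hab hba hcomm
  let σ : (⨁ fun _ : Fin r => ξ) ⟶ ⨁ fun _ : Fin n => structureModule X :=
    biproduct.matrix fun i k => α k i
  let π : (⨁ fun _ : Fin n => structureModule X) ⟶ ⨁ fun _ : Fin r => ξ :=
    biproduct.matrix fun k i => β k i
  have hσπ : σ ≫ π = 𝟙 _ := by
    refine biproduct.hom_ext' _ _ fun i => biproduct.hom_ext _ _ fun i' => ?_
    simp only [σ, π, biproduct.ι_matrix_assoc, Category.assoc, biproduct.matrix_π,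
      biproduct.lift_desc, hαβ, Category.comp_id, biproduct.ι_π]
    split_ifs with h
    · subst h; simp
    · rfl
  let ι := kernel.ι π
  let ρ : (⨁ fun _ : Fin n => structureModule X) ⟶ kernel π :=
    kernel.lift π (𝟙 _ - π ≫ σ) (by simp [Preadditive.sub_comp, hσπ])
  have hρι : ρ ≫ ι = 𝟙 _ - π ≫ σ := kernel.lift_ι _ _ _
  have hιρ : ι ≫ ρ = 𝟙 _ := by
    rw [← cancel_mono ι, Category.assoc, hρι]
    simp [ι, Preadditive.comp_sub]
  have htot : ρ ≫ ι + π ≫ σ = 𝟙 _ := by rw [hρι]; abel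
  have hζ : IsVectorBundleOfRank (kernel π) d := fun x => by
    obtain ⟨j, hj⟩ := exists_endEval_ne_zero hba x
    let m : End (structureModule X) := b j ≫ a j
    -- The matrix of `σ` read through `b j`, which trivializes ξ near `x`; in the application its
    -- entries are y_j l_{ki}/q.
    let A : Matrix (Fin n) (Fin r) (End (structureModule X)) := fun k i => b j ≫ α k i
    have hA : A.transpose * A = m • 1 := by
      ext1 i i'
      rw [Matrix.mul_apply]
      have h1 : ∀ k, A.transpose i k * A k i' = b j ≫ (α k i' ≫ β k i) ≫ a j := fun k => by
        change (b j ≫ α k i') ≫ (b j ≫ α k i) = _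
        rw [hcomm' j k i]
        simp
      simp only [h1]
      rw [← Preadditive.comp_sum, ← Preadditive.sum_comp, hαβ, Matrix.smul_apply,
        Matrix.one_apply, smul_eq_mul]
      by_cases h : i = i'
      · subst h
        simp [m]
      · rw [if_neg h, if_neg (Ne.symm h), zero_comp, comp_zero, mul_zero]
    obtain ⟨d', hd', E, BQ, BT, δ, hδ, h₁, h₂, h₃⟩ := Matrix.exists_complement (endEval x) A m hj hA
    obtain rfl : d' = d := by omega
    -- Inverting the product makes both factors invertible on one open set: `m` so that `b j`
    -- trivializes ξ, and δ so that the completed matrix is invertible.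
    obtain ⟨V, hx, hV⟩ := exists_isIso_restrict (x := x) (e := (m * δ : End (structureModule X)))
      (by rw [map_mul]; exact mul_ne_zero hj hδ)
    have hm : IsIso ((Modules.restrictFunctor V.ι).map (b j ≫ a j)) ∧
        IsIso ((Modules.restrictFunctor V.ι).map δ) := by
      have hu : IsUnit ((Modules.restrictFunctor V.ι).mapEnd _ (m * δ)) :=
        (isUnit_iff_isIso _).2 hV
      rw [map_mul] at hu
      have hc : Commute ((Modules.restrictFunctor V.ι).mapEnd _ m)
          ((Modules.restrictFunctor V.ι).mapEnd _ δ) := by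
        rw [Commute, SemiconjBy, ← map_mul, ← map_mul, mul_comm]
      exact (hc.isUnit_mul_iff.1 hu).imp (isUnit_iff_isIso _).1 (isUnit_iff_isIso _).1
    obtain ⟨hm, hδ'⟩ := hm
    have hb := isIso_restrict_coordinate hab hcomm j (Modules.restrictFunctor V.ι)
    let scal : End (structureModule X) →+* End (structureModule X) := RingHom.id _
    have hAσ : matHom scal A = biproduct.map (fun _ => b j) ≫ σ := by
      refine biproduct.hom_ext' _ _ fun i => biproduct.hom_ext _ _ fun k => ?_
      simp [matHom, σ, A, scal]
    have e1 := congrArg (matHom scal) h₁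
    have e2 := congrArg (matHom scal) h₂
    have e3 := congrArg (matHom scal) h₃
    rw [matHom_add, ← matHom_comp, ← matHom_comp, matHom_smul_one, hAσ] at e1
    rw [← matHom_comp, matHom_zero, hAσ] at e2
    rw [← matHom_comp, matHom_smul_one] at e3
    have h4 := Functor.Additive.isIso_map_biproductMap (I := Fin r)
      (Modules.restrictFunctor V.ι) (b j)
    have h5 := Functor.Additive.isIso_map_biproductMap (I := Fin n)
      (Modules.restrictFunctor V.ι) (scal δ)
    have h6 := Functor.Additive.isIso_map_biproductMap (I := Fin d')
      (Modules.restrictFunctor V.ι) (scal δ)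
    -- On `V` both the kernel of π and the span of the columns of `E` are complements of the image
    -- of `σ`, so the projection `ρ` identifies them.
    have h7 := Functor.Additive.isIso_map_complement (Modules.restrictFunctor V.ι) hσπ hιρ htot
      e1 e2 e3
    obtain ⟨i⟩ := (trivialOn_structureModule V).biproduct d'
    exact ⟨V, hx, ⟨(asIso ((Modules.restrictFunctor V.ι).map (matHom scal E ≫ ρ))).symm ≪≫ i⟩⟩
  refine ⟨kernel π, hζ, ?_⟩
  let S : ShortComplex X.Modules := ShortComplex.mk ι π (kernel.condition π)
  have hS : S.Splitting := { r := ρ, s := σ, f_r := hιρ, s_g := hσπ, id := htot }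
  have h1 := K0.mk_eq_add hS.shortExact hζ.isVectorBundle
    (isLineBundle_structureModule.biproduct n).isVectorBundle (hξ.biproduct r).isVectorBundle
  have h2 := K0.mk_biproduct hξ r
  have h3 := K0.mk_biproduct (isLineBundle_structureModule (X := X)) n
  rw [← h2]
  refine Eq.trans ?_ h3
  rw [add_comm]
  exact h1.symm

end AlgebraicGeometry.Scheme

/-! ### Linear forms on the deleted quadric -/

namespace ProjTwist

open AlgebraicGeometry

variable {A : Type u} {σ : Type u} [CommRing A] [SetLike σ A] [AddSubgroupClass σ A]
variable {𝒜 : ℕ → σ} [GradedRing 𝒜] {U : (Proj 𝒜).Opens} {d : ℤ} {i j : ℕ}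

/-- The section `a / b` of `𝒪(d)`. -/
def fraction (h : (i : ℤ) = j + d) (a : 𝒜 i) (b : 𝒜 j)
    (hb : ∀ x : ProjectiveSpectrum.top 𝒜, x ∈ U → b.1 ∉ x.asHomogeneousIdeal.toIdeal) :
    sections 𝒜 d U :=
  ⟨fun x => Localization.mk a.1 ⟨b.1, hb x.1 x.2⟩,
    fun x => ⟨U, x.2, 𝟙 _, i, j, h, a, b, fun x => hb x.1 x.2, fun _ => rfl⟩⟩

end ProjTwist

namespace SumsOfSquares

open AlgebraicGeometry MvPolynomial ProjTwist

attribute [local instance] MvPolynomial.gradedAlgebra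

variable {F : Type u} [Field F] {r s n : ℕ}

theorem q_isHomogeneous : (q F s).IsHomogeneous 2 :=
  IsHomogeneous.sum _ _ _ fun j _ => by simpa using (isHomogeneous_X F j).pow 2

/-- As `s ≥ 1` there is a first standard basis vector, and `q` takes the value 1 on it. -/
theorem q_ne_zero (hs : 1 ≤ s) : q F s ≠ 0 := fun h => by
  have h1 := congrArg (eval (Pi.single (⟨0, hs⟩ : Fin s) (1 : F))) h
  simp [q, Pi.single_apply, ite_pow] at h1

/-- The columns of the matrix of linear forms of a sums-of-squares formula are orthogonal. -/
theorem FormulaExists.exists_orthogonal (hF : ringChar F ≠ 2) (h : FormulaExists F r s n) :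
    ∃ l : Fin n → Fin r → MvPolynomial (Fin s) F, (∀ k i, (l k i).IsHomogeneous 1) ∧
      ∀ i i', ∑ k, l k i * l k i' = if i = i' then q F s else 0 := by
  obtain ⟨c, hc⟩ := h
  let l : Fin n → Fin r → MvPolynomial (Fin s) F := fun k i => ∑ j, C (c k i j) * X j
  -- Specializing x to a constant vector `v` leaves an identity in F[y]; basis vectors then give the
  -- diagonal entries and sums of two of them the polarization.
  have key : ∀ v : Fin r → F, (∑ i, C (v i) ^ 2) * q F s = ∑ k, (∑ i, C (v i) * l k i) ^ 2 := by
    intro v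
    have h1 := congrArg (aeval (Sum.elim (fun i => C (v i)) X) :
      MvPolynomial (Fin r ⊕ Fin s) F →ₐ[F] MvPolynomial (Fin s) F) hc
    simp only [map_mul, map_sum, map_pow, aeval_X, Sum.elim_inl, Sum.elim_inr, algHom_C,
      algebraMap_eq] at h1
    rw [q, h1]
    refine Finset.sum_congr rfl fun k _ => ?_
    congr 1
    refine Finset.sum_congr rfl fun i _ => ?_
    rw [Finset.mul_sum]
    exact Finset.sum_congr rfl fun j _ => by ring
  have hdiag : ∀ i, ∑ k, l k i * l k i = q F s := fun i => by
    have h1 := key (Pi.single i 1)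
    have h2 : ∀ (f : Fin r → MvPolynomial (Fin s) F),
        ∑ i', C ((Pi.single i 1 : Fin r → F) i') * f i' = f i := fun f => by
      rw [Finset.sum_eq_single i]
      · simp
      · intro j _ hj; simp [hj]
      · simp
    simp only [h2] at h1
    have h3 : ∑ i', (C ((Pi.single i 1 : Fin r → F) i') : MvPolynomial (Fin s) F) ^ 2 = 1 := by
      rw [Finset.sum_eq_single i]
      · simp
      · intro j _ hj; simp [hj]
      · simp
    rw [h3, one_mul] at h1
    rw [h1]
    exact Finset.sum_congr rfl fun k _ => by ring
  refine ⟨l, fun k i => IsHomogeneous.sum _ _ _ fun j _ => ?_, fun i i' => ?_⟩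
  · simpa using (isHomogeneous_C (Fin s) (c k i j)).mul (isHomogeneous_X F j)
  split_ifs with hi
  · subst hi
    exact hdiag i
  · have h1 := key (Pi.single i 1 + Pi.single i' 1)
    have h2 : ∀ (f : Fin r → MvPolynomial (Fin s) F),
        ∑ t, C ((Pi.single i 1 + Pi.single i' 1 : Fin r → F) t) * f t = f i + f i' := fun f => by
      simp only [Pi.add_apply, map_add, add_mul, Finset.sum_add_distrib, Pi.single_apply]
      simp
    have h3 : ∑ t, (C ((Pi.single i 1 + Pi.single i' 1 : Fin r → F) t) :
        MvPolynomial (Fin s) F) ^ 2 = 2 := by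
      simp only [sq]
      rw [h2]
      simp [hi, Ne.symm hi]
      norm_num
    simp only [h2, h3] at h1
    have h4 : ∑ k, (l k i + l k i') ^ 2 =
        ∑ k, l k i * l k i + ∑ k, l k i' * l k i' + 2 * ∑ k, l k i * l k i' := by
      rw [Finset.mul_sum, ← Finset.sum_add_distrib, ← Finset.sum_add_distrib]
      exact Finset.sum_congr rfl fun k _ => by ring
    rw [h4, hdiag, hdiag] at h1
    -- For `i ≠ i'` the identity reads 2q = q + q + 2 ∑ l_{ki} l_{ki'}.
    have h5 : (2 : MvPolynomial (Fin s) F) * ∑ k, l k i * l k i' = 0 := by linear_combination -h1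
    have h6 : (2 : MvPolynomial (Fin s) F) ≠ 0 := by
      rw [show (2 : MvPolynomial (Fin s) F) = C 2 from (map_ofNat C 2).symm]
      exact (map_ne_zero_iff C (C_injective _ _)).2 (Ring.two_ne_zero hF)
    exact (mul_eq_zero.1 h5).resolve_left h6

/-- In the fraction field of F[y] the nonzero `q` is invertible, so the `r` columns of `l` are
independent in a space of dimension `n`. This fixes the rank of ζ before any point of X is chosen.
-/
theorem exists_add_eq (hs : 1 ≤ s) {l : Fin n → Fin r → MvPolynomial (Fin s) F}
    (hl : ∀ i i', ∑ k, l k i * l k i' = if i = i' then q F s else 0) : ∃ d, r + d = n := by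
  obtain ⟨d, hd, -⟩ := Matrix.exists_complement
    (algebraMap (MvPolynomial (Fin s) F) (FractionRing (MvPolynomial (Fin s) F)))
    (Matrix.of l) (q F s)
    ((map_ne_zero_iff _ (IsFractionRing.injective _ _)).2 (q_ne_zero hs)) (by
      ext1 i i'
      simp [Matrix.mul_apply, hl, Matrix.one_apply])
  exact ⟨d, hd⟩

theorem q_notMem (x : ProjectiveSpectrum.top (homogeneousSubmodule (Fin s) F))
    (hx : x ∈ deletedQuadric F s) : q F s ∉ x.asHomogeneousIdeal.toIdeal := hx

/-- A linear form as a section of `𝒪(1)` on the complement of the quadric. -/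
noncomputable def linearSection (l : homogeneousSubmodule (Fin s) F 1) :
    sections (homogeneousSubmodule (Fin s) F) 1 (deletedQuadric F s) :=
  fraction (i := 1) (j := 0) (by simp) l ⟨1, SetLike.GradedOne.one_mem⟩
    fun x _ => (Ideal.ne_top_iff_one _).1 (ProjectiveSpectrum.isPrime x).ne_top

/-- A linear form divided by `q`, as a section of `𝒪(-1)` on the complement of the quadric. -/
noncomputable def linearDivSection (l : homogeneousSubmodule (Fin s) F 1) :
    sections (homogeneousSubmodule (Fin s) F) (-1) (deletedQuadric F s) :=
  fraction (i := 1) (j := 2) (by simp) l ⟨q F s, q_isHomogeneous⟩ q_notMem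

theorem linearSection_mul_linearDivSection (l l' : homogeneousSubmodule (Fin s) F 1)
    (x : deletedQuadric F s) : (linearSection l).1 x * (linearDivSection l').1 x =
      Localization.mk (l.1 * l'.1) ⟨q F s, q_notMem x.1 x.2⟩ := by
  refine (Localization.mk_mul _ _ _ _).trans ?_
  congr 1
  exact Subtype.ext (one_mul _)

theorem sum_linearSection_mul_linearDivSection {ι : Type} [Fintype ι]
    (l l' : ι → homogeneousSubmodule (Fin s) F 1) (x : deletedQuadric F s) :
    ∑ i, (linearSection (l i)).1 x * (linearDivSection (l' i)).1 x =
      Localization.mk (∑ i, (l i).1 * (l' i).1) ⟨q F s, q_notMem x.1 x.2⟩ := by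
  simp only [linearSection_mul_linearDivSection]
  exact (map_sum (AddMonoidHom.mk' (fun a => Localization.mk a ⟨q F s, q_notMem x.1 x.2⟩)
    fun a b => (Localization.add_mk_self a _ b).symm) _ _).symm

/-- Multiplication by a linear form, from `ξ` to `𝒪`. -/
noncomputable def mulLinear (l : homogeneousSubmodule (Fin s) F 1) :
    xi F s ⟶ Scheme.structureModule (deletedQuadric F s).toScheme :=
  mulToUnit _ (by simp) (linearSection l)

/-- Multiplication by a linear form divided by `q`, from `𝒪` to `ξ`. -/
noncomputable def mulLinearDiv (l : homogeneousSubmodule (Fin s) F 1) :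
    Scheme.structureModule (deletedQuadric F s).toScheme ⟶ xi F s :=
  mulFromUnit _ (linearDivSection l)

/-- Both composites are multiplication by l l'/q, which is symmetric in the two forms. -/
theorem mulLinearDiv_mulLinear_comm (l l' : homogeneousSubmodule (Fin s) F 1) :
    mulLinearDiv l ≫ mulLinear l' = mulLinearDiv l' ≫ mulLinear l :=
  mulFromUnit_mulToUnit_congr _ fun x => by
    refine (linearSection_mul_linearDivSection _ _ x).trans ?_
    refine Eq.trans ?_ (linearSection_mul_linearDivSection _ _ x).symm
    rw [mul_comm]

theorem mulLinear_mulLinearDiv_comm (l l' : homogeneousSubmodule (Fin s) F 1) :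
    mulLinear l ≫ mulLinearDiv l' = mulLinear l' ≫ mulLinearDiv l :=
  mulToUnit_mulFromUnit_congr _ fun x => by
    refine (linearSection_mul_linearDivSection _ _ x).trans ?_
    refine Eq.trans ?_ (linearSection_mul_linearDivSection _ _ x).symm
    rw [mul_comm]

section

variable {ι : Type} [Fintype ι] {l l' : ι → homogeneousSubmodule (Fin s) F 1}

theorem sum_mulLinearDiv_mulLinear (h : ∑ i, (l i).1 * (l' i).1 = q F s) :
    ∑ i, mulLinearDiv (l' i) ≫ mulLinear (l i) = 𝟙 _ :=
  sum_mulFromUnit_mulToUnit _ _ _ fun x => by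
    refine (sum_linearSection_mul_linearDivSection l l' x).trans ?_
    have hp := ProjectiveSpectrum.isPrime x.1
    rw [h]
    exact Localization.mk_self (⟨q F s, q_notMem x.1 x.2⟩ :
      x.1.asHomogeneousIdeal.toIdeal.primeCompl)

theorem sum_mulLinear_mulLinearDiv (h : ∑ i, (l i).1 * (l' i).1 = q F s) :
    ∑ i, mulLinear (l i) ≫ mulLinearDiv (l' i) = 𝟙 _ :=
  sum_mulToUnit_mulFromUnit _ _ _ fun x => by
    refine (sum_linearSection_mul_linearDivSection l l' x).trans ?_
    have hp := ProjectiveSpectrum.isPrime x.1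
    rw [h]
    exact Localization.mk_self (⟨q F s, q_notMem x.1 x.2⟩ :
      x.1.asHomogeneousIdeal.toIdeal.primeCompl)

theorem sum_mulLinear_mulLinearDiv_eq_zero (h : ∑ i, (l i).1 * (l' i).1 = 0) :
    ∑ i, mulLinear (l i) ≫ mulLinearDiv (l' i) = 0 :=
  sum_mulToUnit_mulFromUnit_eq_zero _ _ _ fun x => by
    refine (sum_linearSection_mul_linearDivSection l l' x).trans ?_
    rw [h]
    exact Localization.mk_zero _

end

end SumsOfSquares

theorem proposition2p1 {F : Type u} [Field F] (hF : ringChar F ≠ 2) (r s n : ℕ) (hs : 1 ≤ s)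
    (h : SumsOfSquares.FormulaExists F r s n) :
    ∃ (hξ : AlgebraicGeometry.Scheme.IsVectorBundleOfRank (SumsOfSquares.xi F s) 1)
      (ζ : (SumsOfSquares.deletedQuadric F s).toScheme.Modules)
      (d : ℕ) (_ : r + d = n) (hζ : AlgebraicGeometry.Scheme.IsVectorBundleOfRank ζ d),
      r • AlgebraicGeometry.Scheme.K0.mk (SumsOfSquares.xi F s) hξ.isVectorBundle +
          AlgebraicGeometry.Scheme.K0.mk ζ hζ.isVectorBundle =
        n • AlgebraicGeometry.Scheme.K0.unit (SumsOfSquares.deletedQuadric F s).toScheme := by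
  obtain ⟨l, hl1, hl⟩ := h.exists_orthogonal hF
  obtain ⟨d, hd⟩ := SumsOfSquares.exists_add_eq hs hl
  let y : Fin s → MvPolynomial.homogeneousSubmodule (Fin s) F 1 := fun j =>
    ⟨MvPolynomial.X j, MvPolynomial.isHomogeneous_X F j⟩
  let L : Fin n → Fin r → MvPolynomial.homogeneousSubmodule (Fin s) F 1 := fun k i =>
    ⟨l k i, hl1 k i⟩
  -- The coordinates themselves satisfy the quadratic identity that exhibits ξ as a direct summand
  -- of 𝒪ˢ.
  have hy : ∑ j, (y j).1 * (y j).1 = SumsOfSquares.q F s :=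
    Finset.sum_congr rfl fun j _ => (sq _).symm
  have hab := SumsOfSquares.sum_mulLinear_mulLinearDiv hy
  have hba := SumsOfSquares.sum_mulLinearDiv_mulLinear hy
  have hcomm := fun i j => SumsOfSquares.mulLinear_mulLinearDiv_comm (y i) (y j)
  obtain ⟨ζ, hζ, e⟩ := AlgebraicGeometry.Scheme.exists_complement_bundle hab hba hcomm
    (α := fun k i => SumsOfSquares.mulLinear (L k i))
    (β := fun k i => SumsOfSquares.mulLinearDiv (L k i))
    (fun i i' => by
      split_ifs with hi
      · exact SumsOfSquares.sum_mulLinear_mulLinearDiv ((hl i i').trans (if_pos hi))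
      · exact SumsOfSquares.sum_mulLinear_mulLinearDiv_eq_zero ((hl i i').trans (if_neg hi)))
    (fun j k i => SumsOfSquares.mulLinearDiv_mulLinear_comm (y j) (L k i)) hd
  exact ⟨(AlgebraicGeometry.Scheme.isLineBundle_of_projector hab hba hcomm).isVectorBundleOfRank,
    ζ, d, hd, hζ, e⟩
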